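/- Let $d,L\ge 1$ and $p\ge 0$ be integers, let $A_1,\dots,A_L\in\mathbb{R}^{d\times d}$ and $H\in\mathbb{R}^{d\times p}$, and let $W_0,W_1,W_2,\dots$ be independent $N(0,I_p)$ random vectors. Let $Z$ be the vector autoregression $$Z_t=\sum_{l=1}^{L}A_lZ_{t-l}+HW_t,\qquad t=0,1,2,\dots,\qquad Z_{-L}=\dots=Z_{-1}=0,$$ and write $Z_{t:t-L+1}=(Z_t^{\mathsf T},Z_{t-1}^{\mathsf T},\dots,Z_{t-L+1}^{\mathsf T})^{\mathsf T}\in\mathbb{R}^{dL}$. Define $$\kappa=\inf\Big\{k\in\mathbb{N}:\det\Big(\sum_{t=0}^{k-1}\mathbf{E}\,Z_{t:t-L+1}Z_{t:t-L+1}^{\mathsf T}\Big)\neq 0\Big\}\in\mathbb{N}\cup\{\infty\},\qquad \Gamma_k=\frac1k\sum_{t=0}^{k-1}\mathbf{E}\,Z_{t:t-L+1}Z_{t:t-L+1}^{\mathsf T},$$ and let $A\in\mathbb{R}^{dL\times dL}$ be the block companion matrix with first block row $(A_1,\dots,A_L)$, with identity blocks $I_d$ on the first block subdiagonal, and with zeros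 elsewhere. Let $\lambda_{\min}$ denote the smallest eigenvalue of a symmetric matrix and $\|\cdot\|$ the Euclidean operator norm. Then, for all integers $T\ge 1$ and $k\ge\kappa$ such that $k$ divides $T$, $$\mathbf{P}\left(\lambda_{\min}\Big(\frac1T\sum_{t=0}^{T-1}Z_{t:t-L+1}Z_{t:t-L+1}^{\mathsf T}\Big)\le\frac18\lambda_{\min}(\Gamma_k)\right)\le\left(\frac{32\,T^{3/2}\sum_{t=1}^{T}\|HH^{\mathsf T}\|\,\big\|A^{t-1}(A^{t-1})^{\mathsf T}\big\|}{\sqrt{k}\,\lambda_{\min}(\Gamma_k)}\right)^{dL}\exp\left(-\frac{T}{8k}\right).$$ -/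

import Mathlib

open MeasureTheory ProbabilityTheory
open scoped Matrix Matrix.Norms.L2Operator

noncomputable section

namespace VAR

/-- A Gaussian white noise process on `ℝ^p`: the coordinates `(W_t)_i`, over all times `t` and all
indices `i`, are independent standard Gaussians, that is `W_{0:T-1} ∼ N(0, I_{pT})` for every `T`. -/
structure IsGaussianWhiteNoise {Ω : Type*} [MeasurableSpace Ω] (P : Measure Ω) {p : ℕ}
    (W : ℕ → Ω → Fin p → ℝ) : Prop where
  hasLaw : ∀ (t : ℕ) (i : Fin p), HasLaw (fun ω => W t ω i) (gaussianReal 0 1) P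
  indep : iIndepFun (fun (q : ℕ × Fin p) (ω : Ω) => W q.1 ω q.2) P

/-- `Z` is the vector autoregression of order `L` with coefficients `A_1, …, A_L` (here
`A_{l+1}` is `A l` for `l : Fin L`), noise matrix `H`, noise `W` and `Z_{-L:-1} = 0`:
`Z_t = ∑_{l=1}^L A_l Z_{t-l} + H W_t` for `t = 0, 1, 2, …`. -/
structure IsVectorAutoregression {Ω : Type*} {d p L : ℕ}
    (A : Fin L → Matrix (Fin d) (Fin d) ℝ) (H : Matrix (Fin d) (Fin p) ℝ)
    (W : ℕ → Ω → Fin p → ℝ) (Z : ℤ → Ω → Fin d → ℝ) : Prop where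
  init : ∀ t : ℤ, -(L : ℤ) ≤ t → t < 0 → ∀ ω, Z t ω = 0
  step : ∀ (t : ℕ) (ω : Ω),
    Z t ω = ∑ l : Fin L, A l *ᵥ Z ((t : ℤ) - ((l : ℕ) + 1)) ω + H *ᵥ W t ω

/-- The stacked vector `Z_{t:t-L+1} = (Z_t, Z_{t-1}, …, Z_{t-L+1})` in `ℝ^{dL}`. -/
def stack {Ω : Type*} {d : ℕ} (L : ℕ) (Z : ℤ → Ω → Fin d → ℝ) (t : ℕ) (ω : Ω) :
    Fin L × Fin d → ℝ :=
  fun q => Z ((t : ℤ) - (q.1 : ℕ)) ω q.2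

/-- The matrix of second moments `E [X Xᵀ]` of a random vector `X`. -/
def secondMoment {Ω : Type*} [MeasurableSpace Ω] (P : Measure Ω) {n : Type*} (X : Ω → n → ℝ) :
    Matrix n n ℝ :=
  Matrix.of fun i j => ∫ ω, X ω i * X ω j ∂P

/-- The empirical covariance `(1/T) ∑_{t=0}^{T-1} Z_{t:t-L+1} Z_{t:t-L+1}ᵀ`. -/
def empCov {Ω : Type*} {d : ℕ} (L T : ℕ) (Z : ℤ → Ω → Fin d → ℝ) (ω : Ω) :
    Matrix (Fin L × Fin d) (Fin L × Fin d) ℝ :=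
  (1 / (T : ℝ)) • ∑ t ∈ Finset.range T, Matrix.vecMulVec (stack L Z t ω) (stack L Z t ω)

/-- The controllability index: the least `k` (or `⊤`, if there is none) for which
`det (∑_{t=0}^{k-1} E Z_{t:t-L+1} Z_{t:t-L+1}ᵀ) ≠ 0`. -/
def kappa {Ω : Type*} [MeasurableSpace Ω] (P : Measure Ω) {d : ℕ} (L : ℕ)
    (Z : ℤ → Ω → Fin d → ℝ) : ℕ∞ :=
  sInf {m : ℕ∞ | ∃ k : ℕ, m = k ∧
    (∑ t ∈ Finset.range k, secondMoment P (stack L Z t)).det ≠ 0}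

/-- `Γ_k = (1/k) ∑_{t=0}^{k-1} E Z_{t:t-L+1} Z_{t:t-L+1}ᵀ`. -/
def Gam {Ω : Type*} [MeasurableSpace Ω] (P : Measure Ω) {d : ℕ} (L k : ℕ)
    (Z : ℤ → Ω → Fin d → ℝ) : Matrix (Fin L × Fin d) (Fin L × Fin d) ℝ :=
  (1 / (k : ℝ)) • ∑ t ∈ Finset.range k, secondMoment P (stack L Z t)

/-- The block companion matrix: first block row `A_1, …, A_L`, identity blocks on the first block
subdiagonal, and zero elsewhere. -/
def companion {d L : ℕ} (A : Fin L → Matrix (Fin d) (Fin d) ℝ) :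
    Matrix (Fin L × Fin d) (Fin L × Fin d) ℝ :=
  Matrix.of fun q r =>
    if (q.1 : ℕ) = 0 then A r.1 q.2 r.2
    else if (q.1 : ℕ) = (r.1 : ℕ) + 1 ∧ q.2 = r.2 then 1 else 0

/-- The smallest eigenvalue of a real symmetric matrix (of positive size). -/
def lambdaMin {n : Type*} [Fintype n] [DecidableEq n] (M : Matrix n n ℝ) : ℝ :=
  sInf (spectrum ℝ M)

end VAR

end

/-!
The state of a linear system `x_{t+1} = A x_t + B w_t` driven by Gaussian white noise satisfies
`x_{r+j} = A^j x_r + x'_j`, where `x'` is the same system started from `0` with the noise after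
time `r`; it is independent of the past, and `⟨v, x'_j⟩` is centred Gaussian with variance
`respVar A B j v = ∑_{s<j} ‖Bᵀ (Aᵀ)^s v‖²`. The stacked vector autoregression is `x_{t+1}` for the
companion matrix.

*A fixed direction.* Split the `T = m k` times into `m` blocks of length `k`, and let
`τ = ∑_{i<k} respVar (i+1) v = k ⟨v, Γ_k v⟩`. Within a block, convexity of `exp` with weights
`respVar (i+1) v / τ` reduces `E exp (-(3/2) ∑_{i<k} ⟨v, x_{r+i+1}⟩² / τ)`, conditionally on the
past, to one-dimensional integrals `E exp (-(3/2) (a + ξ)² / Var ξ)` of a shifted Gaussian, and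
these are at most `1/2` whatever the shift `a` is. So the Laplace transform over all blocks is at
most `2^{-m}` (`lintegral_block_le`), and Markov's inequality gives
`P (∑_{t<T} ⟨v, x_{t+1}⟩² ≤ T ⟨v, Γ_k v⟩ / 4) ≤ exp (-m/8)` (`measureReal_quadForm_le`).

*All directions.* Let `n` be the dimension, `λ = λ_min(Γ_k)`, `S = ∑_{s<T} ‖H Hᵀ‖ ‖A^s (A^s)ᵀ‖` and
`r = T √m S / λ`, so that the claimed bound is `(32 r)^n exp (-m/8)`. All variances are at most
`S`, hence outside an event of probability at most `2 n T exp (-m/2)` all coordinates of all states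
are at most `√(m S)` in absolute value. There, a unit minimizer `v` of the empirical quadratic form
can be rounded to the grid `{-N, …, N}^n / N`, `N = ⌈r⌉`, with the form still below
`T ⟨w, Γ_k w⟩ / 4` at the rounded vector `w` (`exists_grid_vector`). The rounding error is small
because `n ≤ m / 24`, which may be assumed since otherwise the claimed bound is at least `1`.
The union bound over the `(2N+1)^n` grid points concludes (`measureReal_exists_unit_vector_le`).
-/

open scoped NNReal ENNReal

/-! ### One-dimensional Gaussian estimates -/

/-- The value at `a = 0` is `(1 + 3)^{-1/2} = 1/2`, and a shift only decreases the integral: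
completing the square gives the exact value `exp (-(3/8) a² / v) / 2`. -/
theorem lintegral_exp_neg_shift_gaussianReal_le {v : ℝ≥0} (hv : v ≠ 0) (a : ℝ) :
    ∫⁻ x, ENNReal.ofReal (Real.exp (-(3 / 2) * (a + x) ^ 2 / v)) ∂gaussianReal 0 v ≤ 2⁻¹ := by
  have hv' : (0 : ℝ) < v := by positivity
  have hb : (0 : ℝ) < 2 / v := by positivity
  -- complete the square in the exponent
  have key : ∀ x : ℝ, gaussianPDFReal 0 v x * Real.exp (-(3 / 2) * (a + x) ^ 2 / v) =
      ((√(2 * Real.pi * v))⁻¹ * Real.exp (-(3 / 8) * a ^ 2 / v)) *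
        Real.exp (-(2 / v) * (x + 3 * a / 4) ^ 2) := by
    intro x
    rw [gaussianPDFReal, mul_assoc (√(2 * Real.pi * v))⁻¹, mul_assoc (√(2 * Real.pi * v))⁻¹,
      ← Real.exp_add, ← Real.exp_add]
    congr 2
    field_simp
    ring
  have hint : Integrable (fun x : ℝ => Real.exp (-(2 / v) * (x + 3 * a / 4) ^ 2)) :=
    (integrable_exp_neg_mul_sq hb).comp_add_right (3 * a / 4)
  have hval : ∫ x : ℝ, Real.exp (-(2 / v) * (x + 3 * a / 4) ^ 2) = √(2 * Real.pi * v) / 2 := by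
    rw [integral_add_right_eq_self (fun x : ℝ => Real.exp (-(2 / v) * x ^ 2)), integral_gaussian,
      eq_div_iff two_ne_zero]
    rw [show (2 : ℝ) = √4 by rw [show (4 : ℝ) = 2 ^ 2 by norm_num]; simp]
    rw [← Real.sqrt_mul (by positivity)]
    congr 1
    rw [show √4 = (2 : ℝ) by rw [show (4 : ℝ) = 2 ^ 2 by norm_num]; simp]
    field_simp
    ring
  rw [gaussianReal_of_var_ne_zero 0 hv, lintegral_withDensity_eq_lintegral_mul _
    (measurable_gaussianPDF 0 v) (by fun_prop)]
  have hpt : ∀ x : ℝ, (gaussianPDF 0 v * fun x =>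
      ENNReal.ofReal (Real.exp (-(3 / 2) * (a + x) ^ 2 / v))) x =
      ENNReal.ofReal (((√(2 * Real.pi * v))⁻¹ * Real.exp (-(3 / 8) * a ^ 2 / v)) *
        Real.exp (-(2 / v) * (x + 3 * a / 4) ^ 2)) := by
    intro x
    rw [Pi.mul_apply, gaussianPDF, ← ENNReal.ofReal_mul (gaussianPDFReal_nonneg 0 v x), key]
  simp_rw [hpt]
  rw [← ofReal_integral_eq_lintegral_ofReal (hint.const_mul _)
    (Filter.Eventually.of_forall fun x => by positivity), integral_const_mul, hval]
  have h2 : (2⁻¹ : ℝ≥0∞) = ENNReal.ofReal 2⁻¹ := by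
    rw [ENNReal.ofReal_inv_of_pos two_pos]; simp
  rw [h2]
  apply ENNReal.ofReal_le_ofReal
  have hs : √(2 * Real.pi * v) ≠ 0 := by positivity
  have he : Real.exp (-(3 / 8) * a ^ 2 / v) ≤ 1 := by
    rw [Real.exp_le_one_iff]
    have : 0 ≤ a ^ 2 / v := by positivity
    have e : -(3 / 8) * a ^ 2 / v = -(3 / 8) * (a ^ 2 / v) := by ring
    rw [e]; linarith
  calc _ = Real.exp (-(3 / 8) * a ^ 2 / v) / 2 := by field_simp
    _ ≤ 2⁻¹ := by linarith

/-- Conditional form of `lintegral_exp_neg_shift_gaussianReal_le`: the shift `a` and the weight `F`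
are random, jointly independent of the Gaussian variable `ξ`. -/
theorem lintegral_mul_exp_neg_gaussian_le {Ω : Type*} [MeasurableSpace Ω] {P : Measure Ω}
    [IsProbabilityMeasure P] {F : Ω → ℝ≥0∞} {a ξ : Ω → ℝ} (hF : Measurable F) (ha : Measurable a)
    (hξ : Measurable ξ) (hind : IndepFun (fun ω => (F ω, a ω)) ξ P) {v : ℝ≥0} (hv : v ≠ 0)
    (hlaw : P.map ξ = gaussianReal 0 v) :
    ∫⁻ ω, F ω * ENNReal.ofReal (Real.exp (-(3 / 2) * (a ω + ξ ω) ^ 2 / v)) ∂P ≤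
      (∫⁻ ω, F ω ∂P) * 2⁻¹ := by
  have hg : Measurable fun z : (ℝ≥0∞ × ℝ) × ℝ =>
      z.1.1 * ENNReal.ofReal (Real.exp (-(3 / 2) * (z.1.2 + z.2) ^ 2 / v)) := by fun_prop
  have hmap := lintegral_map (μ := P) hg ((hF.prodMk ha).prodMk hξ)
  rw [← hmap, hind.map_prod_eq_prod_map_map (hF.prodMk ha).aemeasurable hξ.aemeasurable,
    hlaw, lintegral_prod _ hg.aemeasurable]
  calc _ ≤ ∫⁻ y : ℝ≥0∞ × ℝ, y.1 * 2⁻¹ ∂(P.map fun ω => (F ω, a ω)) := by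
        refine lintegral_mono fun y => ?_
        dsimp only
        rw [lintegral_const_mul _ (by fun_prop)]
        gcongr
        exact lintegral_exp_neg_shift_gaussianReal_le hv y.2
    _ = _ := by
        rw [lintegral_map (by fun_prop) (hF.prodMk ha), lintegral_mul_const _ hF]

/-- Gaussian tail bound, from the sub-Gaussian moment generating function. -/
theorem measureReal_gaussian_abs_ge_le {Ω : Type*} [MeasurableSpace Ω] {P : Measure Ω}
    [IsProbabilityMeasure P] {X : Ω → ℝ} (hX : Measurable X) {v : ℝ≥0} {c ε : ℝ}
    (hvc : (v : ℝ) ≤ c) (hc : 0 < c) (hε : 0 ≤ ε) (hlaw : P.map X = gaussianReal 0 v) :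
    P.real {ω | ε ≤ |X ω|} ≤ 2 * Real.exp (-ε ^ 2 / (2 * c)) := by
  have hs : HasSubgaussianMGF X c.toNNReal P := by
    refine ⟨fun t => ?_, fun t => ?_⟩
    · have h := integrable_exp_mul_gaussianReal (μ := 0) (v := v) t
      rw [← hlaw] at h
      exact h.comp_measurable hX
    · rw [mgf_gaussianReal hlaw, Real.coe_toNNReal _ hc.le]
      apply Real.exp_le_exp.2
      nlinarith [sq_nonneg t]
  have h1 := hs.measure_ge_le hε
  have h2 := hs.neg.measure_ge_le hε
  rw [Real.coe_toNNReal _ hc.le] at h1 h2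
  calc P.real {ω | ε ≤ |X ω|} ≤ P.real ({ω | ε ≤ X ω} ∪ {ω | ε ≤ (-X) ω}) := by
        refine measureReal_mono (fun ω hω => ?_) (measure_ne_top _ _)
        exact le_abs.1 (show ε ≤ |X ω| from hω)
    _ ≤ _ := measureReal_union_le _ _
    _ ≤ _ := by linarith

/-! ### Linear systems driven by Gaussian white noise -/

section LinearSystem

variable {n m : Type*} [Fintype n] [Fintype m]

/-- The state of the linear system `x_0 = 0`, `x_{t+1} = A x_t + B w_t`. -/
def linState (A : Matrix n n ℝ) (B : Matrix n m ℝ) (w : ℕ → m → ℝ) : ℕ → n → ℝ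
  | 0 => 0
  | t + 1 => A *ᵥ linState A B w t + B *ᵥ w t

/-- The variance `∑_{s<t} ‖Bᵀ (Aᵀ)^s v‖²` of `⟨v, x_t⟩` for the linear system `x` driven by
standard Gaussian white noise. -/
def respVar [DecidableEq n] (A : Matrix n n ℝ) (B : Matrix n m ℝ) (t : ℕ) (v : n → ℝ) : ℝ :=
  ∑ s ∈ Finset.range t, (Bᵀ *ᵥ (Aᵀ ^ s *ᵥ v)) ⬝ᵥ (Bᵀ *ᵥ (Aᵀ ^ s *ᵥ v))

/-- Restarting the system at time `r`: the state splits into the propagated past and the response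
to the noise after time `r`. -/
theorem linState_add [DecidableEq n] (A : Matrix n n ℝ) (B : Matrix n m ℝ) (w : ℕ → m → ℝ)
    (r j : ℕ) :
    linState A B w (r + j) =
      A ^ j *ᵥ linState A B w r + linState A B (fun t => w (r + t)) j := by
  induction j with
  | zero => simp [linState]
  | succ j ih =>
    rw [← add_assoc, linState, ih, linState, Matrix.mulVec_add, Matrix.mulVec_mulVec,
      ← pow_succ', add_assoc]

theorem respVar_nonneg [DecidableEq n] (A : Matrix n n ℝ) (B : Matrix n m ℝ) (t : ℕ) (v : n → ℝ) :
    0 ≤ respVar A B t v :=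
  Finset.sum_nonneg fun _ _ => Finset.sum_nonneg fun _ _ => mul_self_nonneg _

theorem respVar_succ [DecidableEq n] (A : Matrix n n ℝ) (B : Matrix n m ℝ) (t : ℕ) (v : n → ℝ) :
    respVar A B (t + 1) v = respVar A B t (Aᵀ *ᵥ v) + (Bᵀ *ᵥ v) ⬝ᵥ (Bᵀ *ᵥ v) := by
  simp [respVar, Finset.sum_range_succ', pow_succ]

theorem measurable_linState {Ω : Type*} [MeasurableSpace Ω] (A : Matrix n n ℝ) (B : Matrix n m ℝ)
    {w : ℕ → Ω → m → ℝ} {t : ℕ} (hw : ∀ s < t, ∀ i, Measurable fun ω => w s ω i) :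
    Measurable fun ω => linState A B (fun s => w s ω) t := by
  induction t with
  | zero => exact measurable_const
  | succ t ih =>
    have h1 := ih fun s hs => hw s (by omega)
    have h2 : Measurable fun ω => w t ω := measurable_pi_lambda _ (hw t (by omega))
    have hA : Measurable fun x : n → ℝ => A *ᵥ x := by
      unfold Matrix.mulVec dotProduct; fun_prop
    have hB : Measurable fun x : m → ℝ => B *ᵥ x := by
      unfold Matrix.mulVec dotProduct; fun_prop
    exact (hA.comp h1).add (hB.comp h2)

end LinearSystem

section WhiteNoise

variable {Ω : Type*} {p : ℕ} {W : ℕ → Ω → Fin p → ℝ}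

/-- The `σ`-algebra generated by the noise variables `W_t`, `t ∈ S`. -/
abbrev noiseSigma (W : ℕ → Ω → Fin p → ℝ) (S : Set ℕ) : MeasurableSpace Ω :=
  ⨆ q ∈ {q : ℕ × Fin p | q.1 ∈ S}, MeasurableSpace.comap (fun ω => W q.1 ω q.2) inferInstance

theorem measurable_noiseSigma {S : Set ℕ} {t : ℕ} (ht : t ∈ S) (i : Fin p) :
    Measurable[noiseSigma W S] fun ω => W t ω i := by
  have h : MeasurableSpace.comap (fun ω => W t ω i) inferInstance ≤ noiseSigma W S :=
    le_iSup₂_of_le (f := fun (q : ℕ × Fin p) (_ : q ∈ {q : ℕ × Fin p | q.1 ∈ S}) =>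
      MeasurableSpace.comap (fun ω => W q.1 ω q.2) inferInstance) (t, i) ht le_rfl
  exact (comap_measurable _).mono h le_rfl

theorem measurable_linState_noiseSigma {n : Type*} [Fintype n] (A : Matrix n n ℝ)
    (B : Matrix n (Fin p) ℝ) {S : Set ℕ} {r t : ℕ} (h : ∀ s < t, r + s ∈ S) :
    Measurable[noiseSigma W S] fun ω => linState A B (fun s => W (r + s) ω) t :=
  @measurable_linState _ _ _ _ Ω (noiseSigma W S) A B (fun s => W (r + s)) t
    fun s hs i => measurable_noiseSigma (h s hs) i

variable [MeasurableSpace Ω] {P : Measure Ω}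

theorem indepFun_of_measurable_noiseSigma [IsProbabilityMeasure P]
    (hW : VAR.IsGaussianWhiteNoise P W) (hm : ∀ t i, Measurable fun ω => W t ω i) {S S' : Set ℕ}
    (hS : Disjoint S S') {α β : Type*} [MeasurableSpace α] [MeasurableSpace β] {f : Ω → α}
    {g : Ω → β} (hf : Measurable[noiseSigma W S] f) (hg : Measurable[noiseSigma W S'] g) :
    IndepFun f g P := by
  have h : Indep (noiseSigma W S) (noiseSigma W S') P := by
    refine indep_iSup_of_disjoint
      (m := fun q : ℕ × Fin p => MeasurableSpace.comap (fun ω => W q.1 ω q.2) inferInstance)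
      (fun q => (hm q.1 q.2).comap_le) hW.indep.iIndep ?_
    rw [Set.disjoint_left] at hS ⊢
    exact fun q h1 h2 => hS h1 h2
  rw [IndepFun_iff_Indep]
  exact indep_of_indep_of_le_left (indep_of_indep_of_le_right h hg.comap_le) hf.comap_le

theorem VAR.IsGaussianWhiteNoise.shift (hW : VAR.IsGaussianWhiteNoise P W) (r : ℕ) :
    VAR.IsGaussianWhiteNoise P fun t => W (r + t) where
  hasLaw t i := hW.hasLaw (r + t) i
  indep := hW.indep.precomp (g := fun q : ℕ × Fin p => (r + q.1, q.2)) fun q q' h => by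
    simp only [Prod.mk.injEq, add_right_inj] at h
    exact Prod.ext h.1 h.2

theorem map_sum_mul_noise [IsProbabilityMeasure P] (hW : VAR.IsGaussianWhiteNoise P W)
    (hm : ∀ t i, Measurable fun ω => W t ω i) (t : ℕ) (u : Fin p → ℝ) (s : Finset (Fin p)) :
    P.map (fun ω => ∑ i ∈ s, u i * W t ω i) =
      gaussianReal 0 (∑ i ∈ s, u i * u i).toNNReal := by
  induction s using Finset.induction_on with
  | empty => simp [gaussianReal_zero_var]
  | insert a s ha ih =>
    have hindep : iIndepFun (fun (i : Fin p) ω => u i * W t ω i) P :=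
      (hW.indep.precomp (g := fun i : Fin p => (t, i)) fun i j h => by simpa using h).comp
        (fun i x => u i * x) fun i => by fun_prop
    have hi := (hindep.indepFun_finsetSum_of_notMem (fun i => (hm t i).const_mul _) ha).symm
    have h1 : P.map (fun ω => u a * W t ω a) = gaussianReal 0 (u a * u a).toNNReal := by
      have h := (gaussianReal_const_mul (hW.hasLaw t a) (u a)).map_eq
      simp only [mul_zero, mul_one] at h
      rw [h]
      congr 1
      ext
      simp [pow_two, mul_self_nonneg]
    have e : (∑ i ∈ s, fun ω => u i * W t ω i) = fun ω => ∑ i ∈ s, u i * W t ω i := by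
      ext ω; simp
    rw [e] at hi
    have h := gaussianReal_add_gaussianReal_of_indepFun hi h1 ih
    simp_rw [Finset.sum_insert ha]
    rw [Real.toNNReal_add (mul_self_nonneg _) (Finset.sum_nonneg fun _ _ => mul_self_nonneg _)]
    rw [add_zero] at h
    exact h

theorem map_dotProduct_linState [IsProbabilityMeasure P] {n : Type*} [Fintype n] [DecidableEq n]
    (A : Matrix n n ℝ) (B : Matrix n (Fin p) ℝ) (hW : VAR.IsGaussianWhiteNoise P W)
    (hm : ∀ t i, Measurable fun ω => W t ω i) (t : ℕ) (v : n → ℝ) :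
    P.map (fun ω => v ⬝ᵥ linState A B (fun s => W s ω) t) =
      gaussianReal 0 (respVar A B t v).toNNReal := by
  induction t generalizing v with
  | zero => simp [linState, respVar, gaussianReal_zero_var]
  | succ t ih =>
    have h1 := ih (Aᵀ *ᵥ v)
    have h2 := map_sum_mul_noise hW hm t (Bᵀ *ᵥ v) Finset.univ
    have hdot : ∀ x : n → ℝ, Measurable fun y : n → ℝ => x ⬝ᵥ y := fun x => by
      unfold dotProduct; fun_prop
    have hx : Measurable[noiseSigma W (Set.Iio t)]
        fun ω => linState A B (fun s => W s ω) t := by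
      simpa using measurable_linState_noiseSigma (W := W) A B (S := Set.Iio t) (r := 0) (t := t)
        (by simp)
    have hind : IndepFun (fun ω => (Aᵀ *ᵥ v) ⬝ᵥ linState A B (fun s => W s ω) t)
        (fun ω => ∑ i, (Bᵀ *ᵥ v) i * W t ω i) P := by
      refine indepFun_of_measurable_noiseSigma hW hm (S := Set.Iio t) (S' := {t}) (by simp)
        ((hdot _).comp hx) ?_
      exact Finset.measurable_sum _ fun i _ =>
        (measurable_noiseSigma (Set.mem_singleton t) i).const_mul _
    have h := gaussianReal_add_gaussianReal_of_indepFun hind h1 h2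
    rw [respVar_succ, dotProduct, Real.toNNReal_add (respVar_nonneg ..)
      (Finset.sum_nonneg fun _ _ => mul_self_nonneg _)]
    rw [add_zero] at h
    convert h using 2
    ext ω
    simp only [linState, Pi.add_apply, dotProduct_add, Matrix.dotProduct_mulVec,
      Matrix.mulVec_transpose]
    rfl

end WhiteNoise

/-! ### Smallest eigenvalues and norms -/

section LambdaMin

variable {n m : Type*} [Fintype n] [DecidableEq n] [Fintype m]

theorem lambdaMin_mul_le {M : Matrix n n ℝ} (hM : M.IsHermitian) (v : n → ℝ) :
    VAR.lambdaMin M * (v ⬝ᵥ v) ≤ v ⬝ᵥ (M *ᵥ v) := by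
  open scoped MatrixOrder in
  have h : algebraMap ℝ (Matrix n n ℝ) (VAR.lambdaMin M) ≤ M := by
    refine algebraMap_le_of_le_spectrum (fun x hx => csInf_le ?_ hx) hM.isSelfAdjoint
    rw [hM.spectrum_real_eq_range_eigenvalues]
    exact (Set.finite_range _).bddBelow
  have h2 := (Matrix.le_iff.1 h).dotProduct_mulVec_nonneg v
  rw [Matrix.sub_mulVec, dotProduct_sub, Algebra.algebraMap_eq_smul_one, Matrix.smul_mulVec,
    Matrix.one_mulVec, dotProduct_smul] at h2
  simpa using h2

theorem exists_dotProduct_mulVec_eq_lambdaMin [Nonempty n] {M : Matrix n n ℝ}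
    (hM : M.IsHermitian) : ∃ v : n → ℝ, v ⬝ᵥ v = 1 ∧ v ⬝ᵥ (M *ᵥ v) = VAR.lambdaMin M := by
  have hmem : VAR.lambdaMin M ∈ Set.range hM.eigenvalues := by
    rw [VAR.lambdaMin, hM.spectrum_real_eq_range_eigenvalues]
    exact (Set.range_nonempty _).csInf_mem (Set.finite_range _)
  obtain ⟨i, hi⟩ := hmem
  have h1 : (hM.eigenvectorBasis i).ofLp ⬝ᵥ (hM.eigenvectorBasis i).ofLp = 1 := by
    have h := hM.eigenvectorBasis.orthonormal.1 i
    rw [EuclideanSpace.norm_eq, Real.sqrt_eq_one] at h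
    rw [← h]
    simp [dotProduct, pow_two]
  refine ⟨(hM.eigenvectorBasis i).ofLp, h1, ?_⟩
  rw [hM.mulVec_eigenvectorBasis, dotProduct_smul, h1, hi]
  simp

theorem lambdaMin_pos [Nonempty n] {M : Matrix n n ℝ} (hM : M.PosDef) :
    0 < VAR.lambdaMin M := by
  obtain ⟨v, hv, h⟩ := exists_dotProduct_mulVec_eq_lambdaMin hM.isHermitian
  rw [← h]
  have := hM.dotProduct_mulVec_pos (x := v) (by rintro rfl; simp at hv)
  simpa using this

theorem dotProduct_transpose_mulVec_le (M : Matrix n m ℝ) (v : n → ℝ) :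
    (Mᵀ *ᵥ v) ⬝ᵥ (Mᵀ *ᵥ v) ≤ ‖M * Mᵀ‖ * (v ⬝ᵥ v) := by
  have h0 : v ⬝ᵥ v = ‖WithLp.toLp 2 v‖ ^ 2 := by
    rw [EuclideanSpace.norm_sq_eq]
    simp [dotProduct, pow_two]
  have h := Matrix.l2_opNorm_mulVec Mᵀ (WithLp.toLp 2 v)
  have h2 := Matrix.l2_opNorm_conjTranspose_mul_self Mᵀ
  rw [Matrix.conjTranspose_eq_transpose_of_trivial, Matrix.transpose_transpose] at h2
  rw [h0, h2]
  have h3 : (Mᵀ *ᵥ v) ⬝ᵥ (Mᵀ *ᵥ v) = ‖WithLp.toLp 2 (Mᵀ *ᵥ v)‖ ^ 2 := by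
    rw [EuclideanSpace.norm_sq_eq]
    simp [dotProduct, pow_two]
  rw [h3]
  have h4 : ‖WithLp.toLp 2 (Mᵀ *ᵥ v)‖ ≤ ‖Mᵀ‖ * ‖WithLp.toLp 2 v‖ := h
  calc _ ≤ (‖Mᵀ‖ * ‖WithLp.toLp 2 v‖) ^ 2 := by gcongr
    _ = _ := by ring

theorem respVar_le (A : Matrix n n ℝ) (B : Matrix n m ℝ) {b : ℝ} (hb : 0 ≤ b)
    (hB : ∀ x : n → ℝ, (Bᵀ *ᵥ x) ⬝ᵥ (Bᵀ *ᵥ x) ≤ b * (x ⬝ᵥ x)) {t T : ℕ} (ht : t ≤ T)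
    (v : n → ℝ) :
    respVar A B t v ≤ (∑ s ∈ Finset.range T, b * ‖A ^ s * (A ^ s)ᵀ‖) * (v ⬝ᵥ v) := by
  have hvv : 0 ≤ v ⬝ᵥ v := Finset.sum_nonneg fun _ _ => mul_self_nonneg _
  calc respVar A B t v ≤ ∑ s ∈ Finset.range t, b * ‖A ^ s * (A ^ s)ᵀ‖ * (v ⬝ᵥ v) := by
        refine Finset.sum_le_sum fun s _ => (hB _).trans ?_
        rw [← Matrix.transpose_pow, mul_assoc]
        gcongr
        exact dotProduct_transpose_mulVec_le _ _
    _ ≤ ∑ s ∈ Finset.range T, b * ‖A ^ s * (A ^ s)ᵀ‖ * (v ⬝ᵥ v) := by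
        refine Finset.sum_le_sum_of_subset_of_nonneg (Finset.range_mono ht) fun s _ _ => ?_
        positivity
    _ = _ := by rw [Finset.sum_mul]

end LambdaMin

/-! ### Second moments of the state -/

section Moments

theorem memLp_two_of_map_gaussian {Ω : Type*} [MeasurableSpace Ω] {P : Measure Ω} {X : Ω → ℝ}
    (hX : Measurable X) {v : ℝ≥0} (hlaw : P.map X = gaussianReal 0 v) : MemLp X 2 P := by
  have h := memLp_id_gaussianReal (μ := 0) (v := v) 2
  rw [← hlaw] at h
  exact h.comp_of_map hX.aemeasurable

theorem integral_sq_of_map_gaussian {Ω : Type*} [MeasurableSpace Ω] {P : Measure Ω} {X : Ω → ℝ}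
    (hX : Measurable X) {v : ℝ≥0} (hlaw : P.map X = gaussianReal 0 v) :
    ∫ ω, X ω ^ 2 ∂P = v := by
  have h := integral_map (μ := P) hX.aemeasurable (f := fun x : ℝ => x ^ 2) (by fun_prop)
  rw [← h, hlaw]
  have h2 := variance_fun_id_gaussianReal (μ := 0) (v := v)
  rw [variance_of_integral_eq_zero (by fun_prop) (by simp)] at h2
  simpa using h2

variable {Ω : Type*} [MeasurableSpace Ω] {P : Measure Ω} {p : ℕ} {W : ℕ → Ω → Fin p → ℝ}
  {n : Type*} [Fintype n] [DecidableEq n]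

theorem memLp_linState [IsProbabilityMeasure P] (A : Matrix n n ℝ) (B : Matrix n (Fin p) ℝ)
    (hW : VAR.IsGaussianWhiteNoise P W) (hm : ∀ t i, Measurable fun ω => W t ω i) (t : ℕ) (i : n) :
    MemLp (fun ω => linState A B (fun s => W s ω) t i) 2 P := by
  have hlaw := map_dotProduct_linState A B hW hm t (Pi.single i 1)
  simp only [single_one_dotProduct] at hlaw
  exact memLp_two_of_map_gaussian
    ((measurable_pi_apply i).comp (measurable_linState A B fun s _ j => hm s j)) hlaw

/-- `⟨v, E[x_t x_tᵀ] v⟩` is the variance of `⟨v, x_t⟩`. -/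
theorem dotProduct_secondMoment_linState [IsProbabilityMeasure P] (A : Matrix n n ℝ)
    (B : Matrix n (Fin p) ℝ) (hW : VAR.IsGaussianWhiteNoise P W)
    (hm : ∀ t i, Measurable fun ω => W t ω i) (t : ℕ) (v : n → ℝ) :
    v ⬝ᵥ (VAR.secondMoment P (fun ω => linState A B (fun s => W s ω) t) *ᵥ v) =
      respVar A B t v := by
  have hdot : Measurable fun y : n → ℝ => v ⬝ᵥ y := by unfold dotProduct; fun_prop
  have h := integral_sq_of_map_gaussian
    (hdot.comp (measurable_linState A B fun s (_ : s < t) j => hm s j))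
    (map_dotProduct_linState A B hW hm t v)
  rw [Real.coe_toNNReal _ (respVar_nonneg ..)] at h
  rw [← h]
  set X : Ω → n → ℝ := fun ω => linState A B (fun s => W s ω) t with hXdef
  have hint : ∀ i j, Integrable (fun ω => v i * (X ω i * X ω j * v j)) P := fun i j =>
    (((memLp_linState A B hW hm t i).integrable_mul (memLp_linState A B hW hm t j)).mul_const
      _).const_mul _
  have e : ∀ ω, (v ⬝ᵥ X ω) ^ 2 = ∑ i, ∑ j, v i * (X ω i * X ω j * v j) := by
    intro ω
    rw [pow_two, dotProduct, Finset.sum_mul_sum]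
    exact Finset.sum_congr rfl fun i _ => Finset.sum_congr rfl fun j _ => by ring
  change _ = ∫ ω, (v ⬝ᵥ X ω) ^ 2 ∂P
  simp_rw [e]
  rw [integral_finsetSum _ fun i _ => integrable_finsetSum _ fun j _ => hint i j]
  simp only [dotProduct, Matrix.mulVec, VAR.secondMoment, Matrix.of_apply]
  refine Finset.sum_congr rfl fun i _ => ?_
  rw [integral_finsetSum _ fun j _ => hint i j, Finset.mul_sum]
  refine Finset.sum_congr rfl fun j _ => ?_
  rw [integral_const_mul, integral_mul_const]

theorem posSemidef_secondMoment_linState [IsProbabilityMeasure P] (A : Matrix n n ℝ)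
    (B : Matrix n (Fin p) ℝ) (hW : VAR.IsGaussianWhiteNoise P W)
    (hm : ∀ t i, Measurable fun ω => W t ω i) (t : ℕ) :
    (VAR.secondMoment P (fun ω => linState A B (fun s => W s ω) t)).PosSemidef := by
  refine Matrix.PosSemidef.of_dotProduct_mulVec_nonneg ?_ fun v => ?_
  · ext i j
    simp [VAR.secondMoment, mul_comm]
  · rw [star_trivial, dotProduct_secondMoment_linState A B hW hm]
    exact respVar_nonneg ..

end Moments

/-! ### The quadratic form in a fixed direction -/

/-- Jensen's inequality for `exp` with weights `σ i / ∑ σ`. Terms with `σ i = 0` carry no weight on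
the right, and on the left dropping them only increases the exponential. -/
theorem exp_neg_sum_sq_le {k : ℕ} {σ z : ℕ → ℝ} (hσ : ∀ i, 0 ≤ σ i)
    (hτ : 0 < ∑ i ∈ Finset.range k, σ i) :
    Real.exp (-(3 / 2) / (∑ i ∈ Finset.range k, σ i) * ∑ i ∈ Finset.range k, z i ^ 2) ≤
      ∑ i ∈ Finset.range k, σ i / (∑ i ∈ Finset.range k, σ i) *
        Real.exp (-(3 / 2) * z i ^ 2 / σ i) := by
  set τ := ∑ i ∈ Finset.range k, σ i with hτdef
  have h := convexOn_exp.map_sum_le (t := Finset.range k) (w := fun i => σ i / τ)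
    (p := fun i => -(3 / 2) * z i ^ 2 / σ i) (fun i _ => div_nonneg (hσ i) hτ.le)
    (by rw [← Finset.sum_div, ← hτdef, div_self hτ.ne']) (fun _ _ => Set.mem_univ _)
  simp only [smul_eq_mul] at h
  refine le_trans (Real.exp_le_exp.2 ?_) h
  rw [Finset.mul_sum]
  refine Finset.sum_le_sum fun i _ => ?_
  rcases (hσ i).eq_or_lt with h0 | h0
  · rw [← h0]
    have : 0 ≤ z i ^ 2 / τ := by positivity
    have e : -(3 / 2) / τ * z i ^ 2 = -(3 / 2) * (z i ^ 2 / τ) := by ring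
    rw [e]; simp; linarith
  · apply le_of_eq; field_simp

section Blocks

variable {Ω : Type*} [MeasurableSpace Ω] {P : Measure Ω} {p : ℕ} {W : ℕ → Ω → Fin p → ℝ}
  {n : Type*} [Fintype n] [DecidableEq n]

/-- Laplace transform of the quadratic form over `m` blocks of length `k`: each block contributes a
factor `1/2`, conditionally on the previous ones. -/
theorem lintegral_block_le [IsProbabilityMeasure P] (A : Matrix n n ℝ) (B : Matrix n (Fin p) ℝ)
    (hW : VAR.IsGaussianWhiteNoise P W) (hm : ∀ t i, Measurable fun ω => W t ω i) {k : ℕ}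
    {v : n → ℝ} (hτ : 0 < ∑ i ∈ Finset.range k, respVar A B (i + 1) v) (m : ℕ) :
    ∫⁻ ω, ENNReal.ofReal (Real.exp (-(3 / 2) / (∑ i ∈ Finset.range k, respVar A B (i + 1) v) *
      ∑ t ∈ Finset.range (m * k), (v ⬝ᵥ linState A B (fun s => W s ω) (t + 1)) ^ 2)) ∂P ≤
      2⁻¹ ^ m := by
  induction m with
  | zero => simp
  | succ m ih =>
    set τ := ∑ i ∈ Finset.range k, respVar A B (i + 1) v with hτdef
    have hdot : ∀ x : n → ℝ, Measurable fun y : n → ℝ => x ⬝ᵥ y := fun x => by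
      unfold dotProduct; fun_prop
    have hmul : ∀ M : Matrix n n ℝ, Measurable fun y : n → ℝ => M *ᵥ y := fun M => by
      unfold Matrix.mulVec dotProduct; fun_prop
    set F : Ω → ℝ≥0∞ := fun ω => ENNReal.ofReal (Real.exp (-(3 / 2) / τ *
      ∑ t ∈ Finset.range (m * k), (v ⬝ᵥ linState A B (fun s => W s ω) (t + 1)) ^ 2)) with hFdef
    set a : ℕ → Ω → ℝ := fun i ω =>
      v ⬝ᵥ (A ^ (i + 1) *ᵥ linState A B (fun s => W s ω) (m * k)) with hadef
    set ξ : ℕ → Ω → ℝ := fun i ω =>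
      v ⬝ᵥ linState A B (fun s => W (m * k + s) ω) (i + 1) with hξdef
    have hpast : ∀ t ≤ m * k, Measurable[noiseSigma W (Set.Iio (m * k))]
        fun ω => linState A B (fun s => W s ω) t := fun t ht => by
      simpa using measurable_linState_noiseSigma (W := W) A B (S := Set.Iio (m * k)) (r := 0)
        (t := t) (fun s hs => by simp; omega)
    have hF : Measurable[noiseSigma W (Set.Iio (m * k))] F := by
      refine ENNReal.measurable_ofReal.comp (Real.measurable_exp.comp (Measurable.const_mul ?_ _))
      refine Finset.measurable_sum _ fun t ht => Measurable.pow_const ?_ _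
      exact (hdot v).comp (hpast _ (by have := Finset.mem_range.1 ht; omega))
    have ha : ∀ i, Measurable[noiseSigma W (Set.Iio (m * k))] (a i) := fun i =>
      (hdot v).comp ((hmul _).comp (hpast _ le_rfl))
    have hξ : ∀ i, Measurable[noiseSigma W (Set.Ici (m * k))] (ξ i) := fun i =>
      (hdot v).comp (measurable_linState_noiseSigma (W := W) A B fun s _ => by simp)
    have hle : ∀ S, noiseSigma W S ≤ (inferInstance : MeasurableSpace Ω) := fun S =>
      iSup₂_le fun q _ => (hm q.1 q.2).comap_le
    have hind : ∀ i, IndepFun (fun ω => (F ω, a i ω)) (ξ i) P := fun i =>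
      indepFun_of_measurable_noiseSigma hW hm (S := Set.Iio (m * k)) (S' := Set.Ici (m * k))
        (by rw [Set.disjoint_left]; intro x hx; simpa using hx) (hF.prodMk (ha i)) (hξ i)
    have hF' := hF.mono (hle _) le_rfl
    have ha' := fun i => (ha i).mono (hle _) le_rfl
    have hξ' := fun i => (hξ i).mono (hle _) le_rfl
    have hlaw : ∀ i, P.map (ξ i) = gaussianReal 0 (respVar A B (i + 1) v).toNNReal := fun i =>
      map_dotProduct_linState A B (hW.shift (m * k)) (fun t j => hm (m * k + t) j) (i + 1) v
    have hpt : ∀ ω, ENNReal.ofReal (Real.exp (-(3 / 2) / τ * ∑ t ∈ Finset.range ((m + 1) * k),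
        (v ⬝ᵥ linState A B (fun s => W s ω) (t + 1)) ^ 2)) ≤
        ∑ i ∈ Finset.range k, ENNReal.ofReal (respVar A B (i + 1) v / τ) * (F ω *
          ENNReal.ofReal (Real.exp (-(3 / 2) * (a i ω + ξ i ω) ^ 2 /
            (respVar A B (i + 1) v).toNNReal))) := by
      intro ω
      have e1 : ∀ i, v ⬝ᵥ linState A B (fun s => W s ω) (m * k + i + 1) = a i ω + ξ i ω := by
        intro i
        rw [add_assoc, linState_add, dotProduct_add]
      rw [add_mul, one_mul, Finset.sum_range_add, mul_add, Real.exp_add,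
        ENNReal.ofReal_mul (Real.exp_pos _).le]
      simp_rw [e1]
      have hj := exp_neg_sum_sq_le (k := k) (σ := fun i => respVar A B (i + 1) v)
        (z := fun i => a i ω + ξ i ω) (fun i => respVar_nonneg ..) hτ
      calc _ ≤ F ω * ENNReal.ofReal _ := mul_le_mul_right (ENNReal.ofReal_le_ofReal hj) _
        _ = _ := by
          rw [ENNReal.ofReal_sum_of_nonneg fun i _ => mul_nonneg
            (div_nonneg (respVar_nonneg ..) hτ.le) (Real.exp_pos _).le, Finset.mul_sum]
          refine Finset.sum_congr rfl fun i _ => ?_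
          rw [ENNReal.ofReal_mul (div_nonneg (respVar_nonneg ..) hτ.le),
            Real.coe_toNNReal _ (respVar_nonneg ..)]
          ring
    calc _ ≤ ∫⁻ ω, ∑ i ∈ Finset.range k, ENNReal.ofReal (respVar A B (i + 1) v / τ) * (F ω *
          ENNReal.ofReal (Real.exp (-(3 / 2) * (a i ω + ξ i ω) ^ 2 /
            (respVar A B (i + 1) v).toNNReal))) ∂P := lintegral_mono hpt
      _ = ∑ i ∈ Finset.range k, ENNReal.ofReal (respVar A B (i + 1) v / τ) * ∫⁻ ω, (F ω *
          ENNReal.ofReal (Real.exp (-(3 / 2) * (a i ω + ξ i ω) ^ 2 /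
            (respVar A B (i + 1) v).toNNReal))) ∂P := by
        rw [lintegral_finsetSum _ fun i _ => ?_]
        · refine Finset.sum_congr rfl fun i _ => lintegral_const_mul _ ?_
          have := ha' i
          have := hξ' i
          fun_prop
        · have := ha' i
          have := hξ' i
          fun_prop
      _ ≤ ∑ i ∈ Finset.range k, ENNReal.ofReal (respVar A B (i + 1) v / τ) *
          ((∫⁻ ω, F ω ∂P) * 2⁻¹) := by
        refine Finset.sum_le_sum fun i _ => ?_
        rcases (respVar_nonneg A B (i + 1) v).eq_or_lt with h0 | h0
        · simp [← h0]
        · gcongr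
          exact lintegral_mul_exp_neg_gaussian_le hF' (ha' i) (hξ' i) (hind i)
            (by simpa using h0) (hlaw i)
      _ = (∫⁻ ω, F ω ∂P) * 2⁻¹ := by
        rw [← Finset.sum_mul, ← ENNReal.ofReal_sum_of_nonneg fun i _ =>
          div_nonneg (respVar_nonneg ..) hτ.le, ← Finset.sum_div, ← hτdef, div_self hτ.ne']
        simp
      _ ≤ _ := by rw [pow_succ]; gcongr

/-- Lower tail of the empirical quadratic form in a fixed direction, by Markov's inequality applied
to `lintegral_block_le`: `exp (3m/8) 2^{-m} ≤ exp (-m/8)`. -/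
theorem measureReal_quadForm_le [IsProbabilityMeasure P] (A : Matrix n n ℝ)
    (B : Matrix n (Fin p) ℝ) (hW : VAR.IsGaussianWhiteNoise P W)
    (hm : ∀ t i, Measurable fun ω => W t ω i) {k : ℕ} {v : n → ℝ}
    (hτ : 0 < ∑ i ∈ Finset.range k, respVar A B (i + 1) v) (m : ℕ) :
    P.real {ω | ∑ t ∈ Finset.range (m * k), (v ⬝ᵥ linState A B (fun s => W s ω) (t + 1)) ^ 2 ≤
      m / 4 * ∑ i ∈ Finset.range k, respVar A B (i + 1) v} ≤ Real.exp (-(m : ℝ) / 8) := by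
  have hint := lintegral_block_le A B hW hm hτ m
  set τ := ∑ i ∈ Finset.range k, respVar A B (i + 1) v with hτdef
  set Q : Ω → ℝ := fun ω =>
    ∑ t ∈ Finset.range (m * k), (v ⬝ᵥ linState A B (fun s => W s ω) (t + 1)) ^ 2 with hQ
  have hmeas : Measurable Q := by
    have hdot : Measurable fun y : n → ℝ => v ⬝ᵥ y := by unfold dotProduct; fun_prop
    exact Finset.measurable_sum _ fun t _ =>
      (hdot.comp (measurable_linState A B fun s _ i => hm s i)).pow_const _
  have hmk := mul_meas_ge_le_lintegral (μ := P)
    (f := fun ω => ENNReal.ofReal (Real.exp (-(3 / 2) / τ * Q ω))) (by fun_prop)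
    (ENNReal.ofReal (Real.exp (-(3 / 8) * m)))
  have hsub : {ω | Q ω ≤ m / 4 * τ} ⊆ {ω | ENNReal.ofReal (Real.exp (-(3 / 8) * m)) ≤
      ENNReal.ofReal (Real.exp (-(3 / 2) / τ * Q ω))} := by
    intro ω hω
    apply ENNReal.ofReal_le_ofReal
    apply Real.exp_le_exp.2
    have h1 : Q ω / τ ≤ m / 4 := by rw [div_le_iff₀ hτ]; exact hω
    have e : -(3 / 2) / τ * Q ω = -(3 / 2) * (Q ω / τ) := by ring
    rw [e]; linarith
  have h2 : ENNReal.ofReal (Real.exp (-(3 / 8) * m)) * P {ω | Q ω ≤ m / 4 * τ} ≤ 2⁻¹ ^ m :=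
    (mul_le_mul_right (measure_mono hsub) _).trans (hmk.trans hint)
  have h3 := ENNReal.toReal_mono (by simp) h2
  rw [ENNReal.toReal_mul, ENNReal.toReal_ofReal (Real.exp_pos _).le, ENNReal.toReal_pow,
    ENNReal.toReal_inv, ENNReal.toReal_ofNat] at h3
  -- `√e ≤ 2`
  have h4 : Real.exp (1 / 2) ≤ 2 := by
    have h5 : Real.exp (1 / 2) ^ 2 = Real.exp 1 := by rw [← Real.exp_nat_mul]; norm_num
    have h6 := Real.exp_one_lt_d9
    nlinarith [Real.exp_pos (1 / 2 : ℝ)]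
  have h7 : (2⁻¹ : ℝ) ^ m ≤ Real.exp (-(m : ℝ) / 2) := by
    have e : Real.exp (-(m : ℝ) / 2) = (Real.exp (1 / 2))⁻¹ ^ m := by
      rw [← Real.exp_neg, ← Real.exp_nat_mul]; ring_nf
    rw [e]
    gcongr
  have e : Real.exp (-(m : ℝ) / 2) = Real.exp (-(3 / 8) * m) * Real.exp (-(m : ℝ) / 8) := by
    rw [← Real.exp_add]; ring_nf
  exact le_of_mul_le_mul_left (h3.trans (h7.trans e.le)) (Real.exp_pos _)

end Blocks

/-! ### Discretization of the sphere and union bound -/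

section Discretization

variable {n : Type*} [Fintype n]

/-- Rounding a unit vector `v` at which the empirical quadratic form is small to the grid of mesh
`1/N`. With `η` the rounding error of each `⟨v, x_t⟩`, the form at the rounded vector is at most
`3/2` times the form at `v` plus `3 T η²`, where `η² ≤ λ / 24²`. -/
theorem exists_grid_vector {T N : ℕ} {m S lam : ℝ} {x : ℕ → n → ℝ} {v : n → ℝ}
    (hlam : 0 < lam) (hlamS : lam ≤ S) (hm : 1 ≤ m) (hT : 0 < T)
    (hnT : 24 * (Fintype.card n : ℝ) ≤ T) (hN : T * √m * S / lam ≤ N)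
    (hx : ∀ t < T, ∀ q, |x t q| ≤ √(m * S)) (hv : v ⬝ᵥ v = 1)
    (hQ : ∑ t ∈ Finset.range T, (v ⬝ᵥ x t) ^ 2 ≤ T * lam / 8) :
    ∃ u : n → ℤ, (∀ q, u q ∈ Finset.Icc (-(N : ℤ)) N) ∧
      0 < (fun q => (u q : ℝ) / N) ⬝ᵥ (fun q => (u q : ℝ) / N) ∧
      ∑ t ∈ Finset.range T, ((fun q => (u q : ℝ) / N) ⬝ᵥ x t) ^ 2 ≤
        1 / 4 * T * lam * ((fun q => (u q : ℝ) / N) ⬝ᵥ (fun q => (u q : ℝ) / N)) := by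
  set D : ℝ := (Fintype.card n : ℝ) with hD
  have hD0 : 0 ≤ D := by positivity
  have hT' : (0 : ℝ) < T := by exact_mod_cast hT
  have hS : 0 < S := hlam.trans_le hlamS
  have hsm : 1 ≤ √m := Real.one_le_sqrt.2 hm
  have hsm2 : √m ^ 2 = m := Real.sq_sqrt (by linarith)
  have hNT : (T : ℝ) ≤ N := by
    refine le_trans ?_ hN
    rw [le_div_iff₀ hlam]
    calc (T : ℝ) * lam ≤ T * S := by gcongr
      _ = T * 1 * S := by ring
      _ ≤ T * √m * S := by gcongr
  have hN0 : (0 : ℝ) < N := hT'.trans_le hNT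
  have hv1 : ∀ q, |v q| ≤ 1 := fun q => by
    rw [← sq_le_one_iff_abs_le_one, pow_two, ← hv]
    exact Finset.single_le_sum (f := fun q => v q * v q) (fun _ _ => mul_self_nonneg _)
      (Finset.mem_univ q)
  set u : n → ℤ := fun q => ⌊N * v q⌋ with hu
  set w : n → ℝ := fun q => (u q : ℝ) / N with hw
  have hδ : ∀ q, |w q - v q| ≤ 1 / N := fun q => by
    have h1 := Int.floor_le (N * v q)
    have h2 := Int.lt_floor_add_one (N * v q)
    have e : w q - v q = ((u q : ℝ) - N * v q) / N := by simp only [hw]; field_simp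
    rw [e, abs_div, abs_of_pos hN0]
    gcongr
    rw [abs_le]
    constructor <;> simp only [hu] <;> linarith
  refine ⟨u, fun q => ?_, ?_⟩
  · have h := abs_le.1 (hv1 q)
    rw [Finset.mem_Icc]
    constructor
    · apply Int.le_floor.2
      push_cast
      nlinarith
    · have : (u q : ℝ) ≤ N := (Int.floor_le _).trans (by nlinarith)
      exact_mod_cast this
  have hcard : ∀ c : ℝ, ∑ _q : n, c = D * c := fun c => by simp [hD]
  -- the rounded vector keeps most of its length, in particular it is nonzero
  have hww : 11 / 12 ≤ w ⬝ᵥ w := by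
    have h1 : ∀ q, v q * v q - 2 * (1 / N) ≤ w q * w q := fun q => by
      have h2 : |v q * (w q - v q)| ≤ 1 * (1 / N) := by
        rw [abs_mul]
        exact mul_le_mul (hv1 q) (hδ q) (abs_nonneg _) zero_le_one
      nlinarith [(abs_le.1 h2).1, sq_nonneg (w q - v q)]
    have h3 := Finset.sum_le_sum fun q (_ : q ∈ Finset.univ) => h1 q
    rw [Finset.sum_sub_distrib, hcard] at h3
    have h4 : ∑ q, v q * v q = 1 := hv
    have h5 : D * (2 * (1 / N)) ≤ 1 / 12 := by
      rw [show D * (2 * (1 / (N : ℝ))) = 2 * D / N by ring, div_le_iff₀ hN0]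
      linarith
    have h6 : w ⬝ᵥ w = ∑ q, w q * w q := rfl
    linarith
  refine ⟨by linarith, ?_⟩
  set η : ℝ := D * (1 / N * √(m * S)) with hη
  have hηsq : η ^ 2 ≤ lam / 576 := by
    have e : η ^ 2 = (D / N) ^ 2 * (m * S) := by
      rw [hη, mul_pow, mul_pow, Real.sq_sqrt (by positivity)]; ring
    have h1 : D / N ≤ D * lam / (T * √m * S) := by
      rw [div_le_div_iff₀ hN0 (by positivity)]
      rw [div_le_iff₀ hlam] at hN
      nlinarith
    have h2 : (D * lam / (T * √m * S)) ^ 2 * (m * S) = (D / T) ^ 2 * (lam * (lam / S)) := by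
      rw [div_pow, mul_pow, mul_pow, mul_pow, hsm2]
      field_simp
    have h3 : D / T ≤ 1 / 24 := by rw [div_le_iff₀ hT']; linarith
    have h4 : lam / S ≤ 1 := (div_le_one hS).2 hlamS
    calc η ^ 2 = (D / N) ^ 2 * (m * S) := e
      _ ≤ (D * lam / (T * √m * S)) ^ 2 * (m * S) := by gcongr
      _ = (D / T) ^ 2 * (lam * (lam / S)) := h2
      _ ≤ (1 / 24) ^ 2 * (lam * 1) := by gcongr
      _ = lam / 576 := by ring
  have hpt : ∀ t ∈ Finset.range T, (w ⬝ᵥ x t) ^ 2 ≤ 3 / 2 * (v ⬝ᵥ x t) ^ 2 + 3 * (lam / 576) := by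
    intro t ht
    have h1 : |w ⬝ᵥ x t - v ⬝ᵥ x t| ≤ η := by
      rw [← sub_dotProduct, hη, ← hcard]
      refine (Finset.abs_sum_le_sum_abs _ _).trans (Finset.sum_le_sum fun q _ => ?_)
      rw [abs_mul]
      exact mul_le_mul (hδ q) (hx t (Finset.mem_range.1 ht) q) (abs_nonneg _) (by positivity)
    have h2 : (w ⬝ᵥ x t - v ⬝ᵥ x t) ^ 2 ≤ η ^ 2 := by
      rw [← sq_abs]; gcongr
    nlinarith [sq_nonneg ((w ⬝ᵥ x t - v ⬝ᵥ x t) - v ⬝ᵥ x t / 2)]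
  calc _ ≤ ∑ t ∈ Finset.range T, (3 / 2 * (v ⬝ᵥ x t) ^ 2 + 3 * (lam / 576)) :=
        Finset.sum_le_sum hpt
    _ = 3 / 2 * ∑ t ∈ Finset.range T, (v ⬝ᵥ x t) ^ 2 + T * (3 * (lam / 576)) := by
      rw [Finset.sum_add_distrib, Finset.mul_sum]; simp
    _ ≤ 1 / 4 * T * lam * (11 / 12) := by nlinarith [mul_pos hT' hlam]
    _ ≤ _ := by gcongr

/-- The union bound over grid points and over large coordinates stays below the claimed bound, with
`r = T √m S / λ` and `N = ⌈r⌉`. -/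
theorem union_bound_le {D T N : ℕ} {m r : ℝ} (hD : 0 < D) (hr : 1 ≤ r) (hTr : (T : ℝ) ≤ r)
    (hN : (N : ℝ) ≤ r + 1) (hm : 24 * (D : ℝ) ≤ m) :
    (2 * N + 1 : ℝ) ^ D * Real.exp (-m / 8) + T * D * (2 * Real.exp (-m / 2)) ≤
      (32 * r) ^ D * Real.exp (-m / 8) := by
  have hD' : (1 : ℝ) ≤ D := by exact_mod_cast hD
  have e : Real.exp (-m / 2) = Real.exp (-(3 * m / 8)) * Real.exp (-m / 8) := by
    rw [← Real.exp_add]; ring_nf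
  have h1 : (2 * N + 1 : ℝ) ^ D ≤ (5 / 32) * (32 * r) ^ D := by
    calc (2 * N + 1 : ℝ) ^ D ≤ (5 / 32 * (32 * r)) ^ D := by gcongr; linarith
      _ = (5 / 32) ^ D * (32 * r) ^ D := mul_pow _ _ _
      _ ≤ (5 / 32) * (32 * r) ^ D := by
        gcongr
        exact pow_le_of_le_one (by norm_num) (by norm_num) hD.ne'
  have h2 : D * Real.exp (-(3 * m / 8)) ≤ 1 := by
    rw [Real.exp_neg, ← div_eq_mul_inv, div_le_one (Real.exp_pos _)]
    linarith [Real.add_one_le_exp (3 * m / 8)]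
  have h3 : 32 * r ≤ (32 * r) ^ D := le_self_pow₀ (by linarith) hD.ne'
  have hT0 : (0 : ℝ) ≤ T := by positivity
  have h4 : T * D * (2 * Real.exp (-(3 * m / 8))) ≤ 2 * r := by
    nlinarith
  calc _ = ((2 * N + 1 : ℝ) ^ D + T * D * (2 * Real.exp (-(3 * m / 8)))) * Real.exp (-m / 8) := by
        rw [e]; ring
    _ ≤ _ := by gcongr; linarith

end Discretization

/-- A tail bound `R ^ D * exp (-m / 8)` with `R ≥ 32 ≥ e³` is nontrivial only if the dimension `D`
is small compared with `m`. -/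
theorem card_mul_le_of_pow_mul_exp_lt_one {D : ℕ} {R m : ℝ} (hR : 32 ≤ R)
    (h : R ^ D * Real.exp (-m / 8) < 1) : 24 * (D : ℝ) ≤ m := by
  have h1 : Real.exp 3 ≤ 32 := by
    have e : Real.exp 3 = Real.exp 1 ^ 3 := by rw [← Real.exp_nat_mul]; norm_num
    rw [e]
    calc Real.exp 1 ^ 3 ≤ 3 ^ 3 := by
          gcongr; linarith [Real.exp_one_lt_d9]
      _ ≤ 32 := by norm_num
  have h2 : Real.exp (D * 3) ≤ R ^ D := by
    rw [Real.exp_nat_mul]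
    gcongr
    linarith
  have h3 : Real.exp (D * 3 + -m / 8) < Real.exp 0 := by
    rw [Real.exp_add, Real.exp_zero]
    exact lt_of_le_of_lt (by gcongr) h
  have := Real.exp_lt_exp.1 h3
  linarith

/-- The lower tail of the smallest eigenvalue for a linear system driven by Gaussian white noise,
given a lower bound `lam` on the averaged covariance over one block and an upper bound `S` on the
variances. The smallest eigenvalue being at most `lam / 8` is expressed by a unit vector, which
makes the event's measurability irrelevant. -/
theorem measureReal_exists_unit_vector_le {Ω : Type*} [MeasurableSpace Ω] {P : Measure Ω}
    [IsProbabilityMeasure P] {p : ℕ} {W : ℕ → Ω → Fin p → ℝ} {n : Type*} [Fintype n]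
    [DecidableEq n] [Nonempty n] (A : Matrix n n ℝ) (B : Matrix n (Fin p) ℝ)
    (hW : VAR.IsGaussianWhiteNoise P W) (hmeas : ∀ t i, Measurable fun ω => W t ω i) {k m : ℕ}
    (hk : 0 < k) (hm : 0 < m) {S lam : ℝ} (hlam : 0 < lam)
    (hlow : ∀ v : n → ℝ, lam * (v ⬝ᵥ v) * k ≤ ∑ i ∈ Finset.range k, respVar A B (i + 1) v)
    (hup : ∀ t ≤ m * k, ∀ v : n → ℝ, respVar A B t v ≤ S * (v ⬝ᵥ v)) :
    P.real {ω | ∃ v : n → ℝ, v ⬝ᵥ v = 1 ∧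
      ∑ t ∈ Finset.range (m * k), (v ⬝ᵥ linState A B (fun s => W s ω) (t + 1)) ^ 2 ≤
        (m * k : ℕ) * lam / 8} ≤
      (32 * ((m * k : ℕ) * √m * S / lam)) ^ Fintype.card n * Real.exp (-(m : ℝ) / 8) := by
  have hk' : (0 : ℝ) < k := by exact_mod_cast hk
  have hm1 : (1 : ℝ) ≤ m := by exact_mod_cast hm
  have hT : 0 < m * k := Nat.mul_pos hm hk
  have hT1 : (1 : ℝ) ≤ (m * k : ℕ) := by exact_mod_cast hT
  have hsm : 1 ≤ √(m : ℝ) := Real.one_le_sqrt.2 hm1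
  -- compare the two variance bounds at a coordinate vector
  have hlamS : lam ≤ S := by
    have q : n := Classical.arbitrary n
    have h1 := hlow (Pi.single q 1)
    have h2 : ∑ i ∈ Finset.range k, respVar A B (i + 1) (Pi.single q 1) ≤
        ∑ i ∈ Finset.range k, S * (Pi.single q (1 : ℝ) ⬝ᵥ Pi.single q 1) := by
      refine Finset.sum_le_sum fun i hi => hup _ ?_ _
      have := Finset.mem_range.1 hi
      nlinarith
    simp only [single_one_dotProduct, Pi.single_eq_same, mul_one, Finset.sum_const,
      Finset.card_range, nsmul_eq_mul] at h1 h2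
    have h3 := h1.trans h2
    rw [mul_comm] at h3
    exact le_of_mul_le_mul_left h3 hk'
  have hS : 0 < S := hlam.trans_le hlamS
  set T : ℕ := m * k with hTdef
  set r : ℝ := T * √m * S / lam with hr
  have hTr : (T : ℝ) ≤ r := by
    rw [hr, le_div_iff₀ hlam]
    calc (T : ℝ) * lam ≤ T * S := by gcongr
      _ = T * 1 * S := by ring
      _ ≤ T * √m * S := by gcongr
  have hr1 : 1 ≤ r := hT1.trans hTr
  -- a right-hand side of at least `1` leaves nothing to prove; otherwise `n ≤ m / 24`
  by_cases htriv : 1 ≤ (32 * r) ^ Fintype.card n * Real.exp (-(m : ℝ) / 8)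
  · exact measureReal_le_one.trans htriv
  push Not at htriv
  have hDm : 24 * (Fintype.card n : ℝ) ≤ m :=
    card_mul_le_of_pow_mul_exp_lt_one (by linarith) htriv
  have hmT : (m : ℝ) ≤ T := by
    exact_mod_cast Nat.le_mul_of_pos_right m hk
  set N : ℕ := ⌈r⌉₊ with hN
  set w : (n → ℤ) → n → ℝ := fun u q => (u q : ℝ) / N with hw
  set X : ℕ → Ω → n → ℝ := fun t ω => linState A B (fun s => W s ω) (t + 1) with hX
  set G : Finset (n → ℤ) := (Fintype.piFinset fun _ => Finset.Icc (-(N : ℤ)) N).filter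
    fun u => 0 < w u ⬝ᵥ w u with hG
  set E : (n → ℤ) → Set Ω := fun u =>
    {ω | ∑ t ∈ Finset.range T, (w u ⬝ᵥ X t ω) ^ 2 ≤
      m / 4 * ∑ i ∈ Finset.range k, respVar A B (i + 1) (w u)} with hE
  set K : ℕ × n → Set Ω := fun q => {ω | √(m * S) ≤ |X q.1 ω q.2|} with hK
  have hsub : {ω | ∃ v : n → ℝ, v ⬝ᵥ v = 1 ∧
      ∑ t ∈ Finset.range T, (v ⬝ᵥ X t ω) ^ 2 ≤ T * lam / 8} ⊆
      (⋃ u ∈ G, E u) ∪ ⋃ q ∈ Finset.range T ×ˢ (Finset.univ : Finset n), K q := by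
    rintro ω ⟨v, hv, hQ⟩
    by_cases hbig : ∃ t < T, ∃ q, √(m * S) ≤ |X t ω q|
    · obtain ⟨t, ht, q, hq⟩ := hbig
      right
      simp only [Set.mem_iUnion]
      exact ⟨(t, q), by simpa using ht, hq⟩
    · -- all coordinates are small, so the minimizer can be rounded
      push Not at hbig
      left
      obtain ⟨u, hu, hu0, huQ⟩ := exists_grid_vector (x := fun t => X t ω) hlam hlamS hm1 hT
        (hDm.trans hmT) (Nat.le_ceil r) (fun t ht q => (hbig t ht q).le) hv hQ
      simp only [Set.mem_iUnion]
      refine ⟨u, ?_, ?_⟩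
      · rw [hG, Finset.mem_filter, Fintype.mem_piFinset]
        exact ⟨hu, hu0⟩
      · refine huQ.trans ?_
        have h := hlow (w u)
        calc 1 / 4 * (T : ℝ) * lam * (w u ⬝ᵥ w u)
            = m / 4 * (lam * (w u ⬝ᵥ w u) * k) := by rw [hTdef]; push_cast; ring
          _ ≤ _ := by gcongr
  have hEu : ∀ u ∈ G, P.real (E u) ≤ Real.exp (-(m : ℝ) / 8) := by
    intro u hu
    have hu0 : 0 < w u ⬝ᵥ w u := (Finset.mem_filter.1 hu).2
    exact measureReal_quadForm_le A B hW hmeas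
      (lt_of_lt_of_le (by positivity) (hlow (w u))) m
  have hKq : ∀ q ∈ Finset.range T ×ˢ (Finset.univ : Finset n),
      P.real (K q) ≤ 2 * Real.exp (-(m : ℝ) / 2) := by
    intro q hq
    have hqT : q.1 + 1 ≤ T := by simpa using hq
    have hlaw := map_dotProduct_linState A B hW hmeas (q.1 + 1) (Pi.single q.2 1)
    simp only [single_one_dotProduct] at hlaw
    have hvar := hup (q.1 + 1) hqT (Pi.single q.2 1)
    rw [single_one_dotProduct, Pi.single_eq_same, mul_one] at hvar
    have h := measureReal_gaussian_abs_ge_le (ε := √(m * S))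
      (X := fun ω => linState A B (fun s => W s ω) (q.1 + 1) q.2)
      ((measurable_pi_apply q.2).comp
        (measurable_linState A B (t := q.1 + 1) fun s _ j => hmeas s j))
      (by rwa [Real.coe_toNNReal _ (respVar_nonneg ..)]) hS (Real.sqrt_nonneg _) hlaw
    refine h.trans (le_of_eq ?_)
    rw [Real.sq_sqrt (by positivity)]
    congr 2
    field_simp
  have hGcard : (G.card : ℝ) ≤ (2 * N + 1 : ℝ) ^ Fintype.card n := by
    have h : G.card ≤ (2 * N + 1) ^ Fintype.card n := by
      refine (Finset.card_filter_le _ _).trans (le_of_eq ?_)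
      rw [Fintype.card_piFinset, Finset.prod_const, Int.card_Icc, Finset.card_univ]
      congr 1
      omega
    exact_mod_cast h
  calc _ ≤ P.real ((⋃ u ∈ G, E u) ∪
          ⋃ q ∈ Finset.range T ×ˢ (Finset.univ : Finset n), K q) :=
        measureReal_mono hsub (measure_ne_top _ _)
    _ ≤ P.real (⋃ u ∈ G, E u) +
          P.real (⋃ q ∈ Finset.range T ×ˢ (Finset.univ : Finset n), K q) :=
        measureReal_union_le _ _
    _ ≤ ∑ u ∈ G, P.real (E u) +
          ∑ q ∈ Finset.range T ×ˢ (Finset.univ : Finset n), P.real (K q) :=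
        add_le_add (measureReal_biUnion_finset_le _ _) (measureReal_biUnion_finset_le _ _)
    _ ≤ G.card * Real.exp (-(m : ℝ) / 8) +
          T * Fintype.card n * (2 * Real.exp (-(m : ℝ) / 2)) := by
        refine add_le_add ((Finset.sum_le_card_nsmul _ _ _ hEu).trans (le_of_eq (by simp)))
          ((Finset.sum_le_card_nsmul _ _ _ hKq).trans (le_of_eq ?_))
        rw [Finset.card_product, Finset.card_range, Finset.card_univ, nsmul_eq_mul]
        push_cast
        ring
    _ ≤ (2 * N + 1 : ℝ) ^ Fintype.card n * Real.exp (-(m : ℝ) / 8) +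
          T * Fintype.card n * (2 * Real.exp (-(m : ℝ) / 2)) := by gcongr
    _ ≤ _ := union_bound_le Fintype.card_pos hr1 hTr (Nat.ceil_lt_add_one (by linarith)).le hDm

/-! ### The vector autoregression as a linear system -/

/-- The matrix feeding the noise `H W_t` into the first block of the stacked vector. -/
def stackedNoise {d p : ℕ} (L : ℕ) (H : Matrix (Fin d) (Fin p) ℝ) :
    Matrix (Fin L × Fin d) (Fin p) ℝ :=
  Matrix.of fun q j => if (q.1 : ℕ) = 0 then H q.2 j else 0

/-- The index shift by one accounts for the first noise variable `W_0` entering `Z_0`: the state at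
time `0` is the vanishing initial segment `Z_{-1:-L}`. -/
theorem stack_eq_linState {Ω : Type*} {d p L : ℕ} {A : Fin L → Matrix (Fin d) (Fin d) ℝ}
    {H : Matrix (Fin d) (Fin p) ℝ} {W : ℕ → Ω → Fin p → ℝ} {Z : ℤ → Ω → Fin d → ℝ}
    (hZ : VAR.IsVectorAutoregression A H W Z) (t : ℕ) (ω : Ω) :
    VAR.stack L Z t ω =
      linState (VAR.companion A) (stackedNoise L H) (fun s => W s ω) (t + 1) := by
  -- the state at time `t` is the stacked vector ending at time `t - 1`
  have key : ∀ t : ℕ, (fun q : Fin L × Fin d => Z ((t : ℤ) - 1 - (q.1 : ℕ)) ω q.2) =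
      linState (VAR.companion A) (stackedNoise L H) (fun s => W s ω) t := by
    intro t
    induction t with
    | zero =>
      ext q
      have h := q.1.isLt
      rw [hZ.init _ (by push_cast; omega) (by push_cast; omega)]
      rfl
    | succ t ih =>
      rw [linState, ← ih]
      ext q
      obtain ⟨l, i⟩ := q
      simp only [Pi.add_apply, Matrix.mulVec, dotProduct, VAR.companion, stackedNoise,
        Matrix.of_apply]
      by_cases hl : (l : ℕ) = 0
      · have hst := congrFun (hZ.step t ω) i
        simp only [Pi.add_apply, Finset.sum_apply, Matrix.mulVec, dotProduct] at hst
        simp only [hl, if_true]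
        rw [Fintype.sum_prod_type]
        have e : ((t + 1 : ℕ) : ℤ) - 1 - ((0 : ℕ) : ℤ) = t := by push_cast; ring
        rw [e, hst]
        congr 1
        refine Finset.sum_congr rfl fun l' _ => Finset.sum_congr rfl fun j _ => ?_
        rw [show (t : ℤ) - ((l' : ℕ) + 1) = (t : ℤ) - 1 - (l' : ℕ) by ring]
      · simp only [hl, if_false, zero_mul, Finset.sum_const_zero, add_zero]
        have hl1 : (l : ℕ) - 1 < L := by have := l.isLt; omega
        rw [Finset.sum_eq_single (⟨(l : ℕ) - 1, hl1⟩, i)]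
        · rw [if_pos ⟨by simp only; omega, rfl⟩, one_mul]
          have e : ((t + 1 : ℕ) : ℤ) - 1 - ((l : ℕ) : ℤ) = t - 1 - (((l : ℕ) - 1 : ℕ) : ℤ) := by
            omega
          rw [e]
        · rintro ⟨l', j⟩ - hne
          rw [if_neg, zero_mul]
          rintro ⟨h1, h2⟩
          refine hne (Prod.ext (Fin.ext ?_) h2.symm)
          simp only at h1 ⊢
          omega
        · simp
  rw [← key]
  ext q
  simp [VAR.stack]

theorem dotProduct_transpose_stackedNoise_mulVec_le {d p L : ℕ} (hL : 0 < L)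
    (H : Matrix (Fin d) (Fin p) ℝ) (x : Fin L × Fin d → ℝ) :
    ((stackedNoise L H)ᵀ *ᵥ x) ⬝ᵥ ((stackedNoise L H)ᵀ *ᵥ x) ≤ ‖H * Hᵀ‖ * (x ⬝ᵥ x) := by
  have e : (stackedNoise L H)ᵀ *ᵥ x = Hᵀ *ᵥ fun i => x (⟨0, hL⟩, i) := by
    ext j
    simp only [Matrix.mulVec, dotProduct, stackedNoise, Matrix.transpose_apply, Matrix.of_apply]
    rw [Fintype.sum_prod_type, Finset.sum_eq_single ⟨0, hL⟩]
    · simp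
    · intro l _ hl
      have : (l : ℕ) ≠ 0 := fun h => hl (Fin.ext h)
      simp [this]
    · simp
  rw [e]
  refine (dotProduct_transpose_mulVec_le H _).trans ?_
  gcongr
  rw [dotProduct, dotProduct, Fintype.sum_prod_type]
  exact Finset.single_le_sum (f := fun l => ∑ i, x (l, i) * x (l, i))
    (fun _ _ => Finset.sum_nonneg fun _ _ => mul_self_nonneg _) (Finset.mem_univ _)

/-- The variables of a white noise are only almost everywhere measurable; this passes to measurable
versions, so that the `σ`-algebras they generate are contained in the ambient one. -/
theorem VAR.IsGaussianWhiteNoise.exists_measurable_modification {Ω : Type*} [MeasurableSpace Ω]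
    {P : Measure Ω} {p : ℕ} {W : ℕ → Ω → Fin p → ℝ} (hW : VAR.IsGaussianWhiteNoise P W) :
    ∃ W' : ℕ → Ω → Fin p → ℝ, VAR.IsGaussianWhiteNoise P W' ∧
      (∀ t i, Measurable fun ω => W' t ω i) ∧ ∀ᵐ ω ∂P, ∀ t, W t ω = W' t ω := by
  have hae := fun (t : ℕ) (i : Fin p) => (hW.hasLaw t i).aemeasurable
  have heq := fun (t : ℕ) (i : Fin p) => (hae t i).ae_eq_mk
  refine ⟨fun t ω i => (hae t i).mk _ ω, ⟨fun t i => (hW.hasLaw t i).congr (heq t i).symm, ?_⟩,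
    fun t i => (hae t i).measurable_mk, ?_⟩
  · exact (iIndepFun_congr fun q : ℕ × Fin p => heq q.1 q.2).1 hW.indep
  · have h : ∀ᵐ ω ∂P, ∀ t i, W t ω i = (hae t i).mk _ ω :=
      ae_all_iff.2 fun t => ae_all_iff.2 fun i => heq t i
    filter_upwards [h] with ω hω t
    exact funext (hω t)

theorem isHermitian_empCov {Ω : Type*} {d : ℕ} (L T : ℕ) (Z : ℤ → Ω → Fin d → ℝ) (ω : Ω) :
    (VAR.empCov L T Z ω).IsHermitian := by
  ext q r
  simp [VAR.empCov, Matrix.sum_apply, Matrix.vecMulVec_apply, mul_comm]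

theorem dotProduct_empCov_mulVec {Ω : Type*} {d : ℕ} (L T : ℕ) (Z : ℤ → Ω → Fin d → ℝ) (ω : Ω)
    (v : Fin L × Fin d → ℝ) : v ⬝ᵥ (VAR.empCov L T Z ω *ᵥ v) =
      1 / (T : ℝ) * ∑ t ∈ Finset.range T, (v ⬝ᵥ VAR.stack L Z t ω) ^ 2 := by
  rw [VAR.empCov, Matrix.smul_mulVec, dotProduct_smul, Matrix.sum_mulVec, dotProduct_sum,
    smul_eq_mul]
  congr 1
  refine Finset.sum_congr rfl fun t _ => ?_
  rw [Matrix.vecMulVec_mulVec, dotProduct_smul, dotProduct_comm (VAR.stack L Z t ω) v]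
  simp [pow_two]

/-- The infimum defining `κ` is attained when finite. -/
theorem exists_le_det_ne_zero_of_kappa_le {Ω : Type*} [MeasurableSpace Ω] {P : Measure Ω}
    {d L k : ℕ} {Z : ℤ → Ω → Fin d → ℝ} (hk : VAR.kappa P L Z ≤ (k : ℕ∞)) :
    ∃ j ≤ k, (∑ t ∈ Finset.range j, VAR.secondMoment P (VAR.stack L Z t)).det ≠ 0 := by
  have hne : {m : ℕ∞ | ∃ k : ℕ, m = k ∧
      (∑ t ∈ Finset.range k, VAR.secondMoment P (VAR.stack L Z t)).det ≠ 0}.Nonempty := by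
    by_contra h
    rw [VAR.kappa, Set.not_nonempty_iff_eq_empty.1 h, sInf_empty] at hk
    exact ENat.natCast_ne_top k (top_le_iff.1 hk)
  obtain ⟨j, hj, hdet⟩ := csInf_mem hne
  refine ⟨j, ?_, hdet⟩
  rw [VAR.kappa, hj] at hk
  exact_mod_cast hk

theorem corollary1 {Ω : Type*} [MeasurableSpace Ω] (P : Measure Ω) [IsProbabilityMeasure P]
    {d p L : ℕ} (hd : 0 < d) (hL : 0 < L)
    (A : Fin L → Matrix (Fin d) (Fin d) ℝ) (H : Matrix (Fin d) (Fin p) ℝ)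
    (W : ℕ → Ω → Fin p → ℝ) (hW : VAR.IsGaussianWhiteNoise P W)
    (Z : ℤ → Ω → Fin d → ℝ) (hZ : VAR.IsVectorAutoregression A H W Z)
    (T k : ℕ) (hT : 0 < T) (hk : VAR.kappa P L Z ≤ (k : ℕ∞)) (hkT : k ∣ T) :
    P.real {ω | VAR.lambdaMin (VAR.empCov L T Z ω) ≤ 1 / 8 * VAR.lambdaMin (VAR.Gam P L k Z)} ≤
      (32 * (T : ℝ) ^ (3 / 2 : ℝ) *
          (∑ t ∈ Finset.Icc 1 T, ‖H * Hᵀ‖ *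
            ‖VAR.companion A ^ (t - 1) * (VAR.companion A ^ (t - 1))ᵀ‖) /
        (√(k : ℝ) * VAR.lambdaMin (VAR.Gam P L k Z))) ^ (d * L) *
      Real.exp (-(T : ℝ) / (8 * (k : ℝ))) := by
  obtain ⟨m, hm⟩ := hkT
  rw [mul_comm] at hm
  subst hm
  -- `k = 0` is excluded because it would have to divide `T > 0`
  have hk0 : 0 < k := Nat.pos_of_mul_pos_left hT
  have hm0 : 0 < m := Nat.pos_of_mul_pos_right hT
  have hk' : (0 : ℝ) < k := by exact_mod_cast hk0
  have hm' : (0 : ℝ) < m := by exact_mod_cast hm0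
  have : Nonempty (Fin L × Fin d) := ⟨(⟨0, hL⟩, ⟨0, hd⟩)⟩
  set C := VAR.companion A with hC
  set B := stackedNoise L H with hB
  obtain ⟨W', hW', hmeas, hWW'⟩ := hW.exists_measurable_modification
  have hstack : ∀ᵐ ω ∂P, ∀ t, VAR.stack L Z t ω = linState C B (fun s => W' s ω) (t + 1) := by
    filter_upwards [hWW'] with ω hω t
    rw [stack_eq_linState hZ]
    simp only [hω, hC, hB]
  have hsm : ∀ t, VAR.secondMoment P (VAR.stack L Z t) =
      VAR.secondMoment P (fun ω => linState C B (fun s => W' s ω) (t + 1)) := by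
    intro t
    ext i j
    refine integral_congr_ae ?_
    filter_upwards [hstack] with ω hω
    rw [hω]
  have hquad : ∀ (j : ℕ) v, v ⬝ᵥ
      ((∑ t ∈ Finset.range j, VAR.secondMoment P (VAR.stack L Z t)) *ᵥ v) =
      ∑ t ∈ Finset.range j, respVar C B (t + 1) v := by
    intro j v
    rw [Matrix.sum_mulVec, dotProduct_sum]
    refine Finset.sum_congr rfl fun t _ => ?_
    rw [hsm, dotProduct_secondMoment_linState C B hW' hmeas]
  have hpsd : ∀ j : ℕ,
      (∑ t ∈ Finset.range j, VAR.secondMoment P (VAR.stack L Z t)).PosSemidef := fun j =>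
    Matrix.posSemidef_sum _ fun t _ => by
      rw [hsm]; exact posSemidef_secondMoment_linState C B hW' hmeas (t + 1)
  have hpd : (∑ t ∈ Finset.range k, VAR.secondMoment P (VAR.stack L Z t)).PosDef := by
    obtain ⟨j, hjk, hdet⟩ := exists_le_det_ne_zero_of_kappa_le hk
    refine Matrix.PosDef.of_dotProduct_mulVec_pos (hpsd k).isHermitian fun x hx => ?_
    have h := ((hpsd j).posDef_iff_det_ne_zero.2 hdet).dotProduct_mulVec_pos hx
    rw [star_trivial, hquad] at h ⊢
    exact h.trans_le (Finset.sum_le_sum_of_subset_of_nonneg (Finset.range_mono hjk)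
      fun _ _ _ => respVar_nonneg ..)
  have hGpd : (VAR.Gam P L k Z).PosDef := hpd.smul (by positivity)
  set lam := VAR.lambdaMin (VAR.Gam P L k Z) with hlamdef
  have hlam : 0 < lam := lambdaMin_pos hGpd
  set S : ℝ := ∑ s ∈ Finset.range (m * k), ‖H * Hᵀ‖ * ‖C ^ s * (C ^ s)ᵀ‖ with hS
  have hlow : ∀ v, lam * (v ⬝ᵥ v) * k ≤ ∑ i ∈ Finset.range k, respVar C B (i + 1) v := by
    intro v
    have h := lambdaMin_mul_le hGpd.isHermitian v
    have e : v ⬝ᵥ (VAR.Gam P L k Z *ᵥ v) =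
        (∑ i ∈ Finset.range k, respVar C B (i + 1) v) / k := by
      rw [VAR.Gam, Matrix.smul_mulVec, dotProduct_smul, hquad, smul_eq_mul, one_div,
        inv_mul_eq_div]
    rwa [e, le_div_iff₀ hk'] at h
  have hmain := measureReal_exists_unit_vector_le C B hW' hmeas hk0 hm0 hlam hlow
    (S := S) fun t ht v => respVar_le C B (norm_nonneg _)
      (dotProduct_transpose_stackedNoise_mulVec_le hL H) ht v
  have hsum : ∑ t ∈ Finset.Icc 1 (m * k), ‖H * Hᵀ‖ * ‖C ^ (t - 1) * (C ^ (t - 1))ᵀ‖ = S := by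
    rw [← Finset.Ico_add_one_right_eq_Icc, Finset.sum_Ico_eq_sum_range]
    simp [hS]
  have hT' : (0 : ℝ) < (m * k : ℕ) := by exact_mod_cast hT
  have hpow : ((m * k : ℕ) : ℝ) ^ (3 / 2 : ℝ) = (m * k : ℕ) * (√m * √k) := by
    rw [← Real.sqrt_mul hm'.le, Real.sqrt_eq_rpow, show (3 / 2 : ℝ) = 1 + 1 / 2 by norm_num,
      Real.rpow_add hT', Real.rpow_one]
    push_cast
    rfl
  have hsk : √(k : ℝ) ≠ 0 := by positivity
  have hbase : 32 * ((m * k : ℕ) : ℝ) ^ (3 / 2 : ℝ) * S / (√(k : ℝ) * lam) =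
      32 * ((m * k : ℕ) * √m * S / lam) := by
    rw [hpow]
    field_simp
  have hexp : -((m * k : ℕ) : ℝ) / (8 * k) = -(m : ℝ) / 8 := by
    push_cast
    field_simp
  have hcard : Fintype.card (Fin L × Fin d) = d * L := by simp [mul_comm]
  rw [hsum, hbase, hexp, ← hcard]
  refine le_trans (ENNReal.toReal_mono (measure_ne_top _ _) (measure_mono_ae ?_)) hmain
  filter_upwards [hstack] with ω hω hle
  obtain ⟨v, hv, hvM⟩ := exists_dotProduct_mulVec_eq_lambdaMin (isHermitian_empCov L (m * k) Z ω)
  refine ⟨v, hv, ?_⟩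
  have h : VAR.lambdaMin (VAR.empCov L (m * k) Z ω) ≤ 1 / 8 * lam := hle
  rw [← hvM, dotProduct_empCov_mulVec, one_div, inv_mul_eq_div, div_le_iff₀ hT'] at h
  simp only [hω] at h
  linarith
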